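/- Let $N\in\mathbb S^2\subset\mathbb R^3$ be a point of the round unit sphere, let $S=-N$, and let $\vec v$ be a unit vector field of class $C^1$ tangent to $\mathbb S^2$ and defined on $M=\mathbb S^2\setminus\{N,S\}$. Let $I_{\vec v}(P)\in\mathbb Z$ denote the Poincaré index of $\vec v$ at $P\in\{N,S\}$: the number of turns of $\vec v$, read in a chart of $\mathbb S^2$ centred at $P$, along a small circle around $P$ traversed once. The volume $\mathrm{vol}(\vec v)\in[0,\infty]$ is the area of the surface $\vec v(M)$ in the unit tangent bundle $T^1\mathbb S^2$ with the Sasaki metric $g_{\mathrm{Sas}}$, that is, $$\mathrm{vol}(\vec v)=\int_M \sqrt{\det\bigl((\vec v^{\,*}g_{\mathrm{Sas}})(E_i,E_j)\bigr)_{i,j=1,2}}\;dA,$$ where $dA$ is the area element of the round metric $g$, $(E_1,E_2)$ is any $g$-orthonormal basis of the tangent plane, and $(\vec v^{\,*}g_{\mathrm{Sas}})(X,Y)=g(X,Y)+g(\nabla_X\vec v,\nabla_Y\vec v)$ with $\nabla$ the Levi-Civita connection of $g$. Let $k=\max\{I_{\vec v}(N),I_{\vec v}(S)\}$ and suppose that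 $k>2$. Then $$\mathrm{vol}(\vec v)\ \ge\ \pi\,L(\xi_k),$$ where $L(\xi_k)$ is the length of the ellipse $\xi_k:\ \dfrac{x^2}{k^2}+\dfrac{y^2}{(k-2)^2}=1$. -/

import Mathlib

open scoped Manifold Topology InnerProductSpace

noncomputable section

namespace SphereField

/-- Euclidean three-space. -/
abbrev E3 : Type := EuclideanSpace ℝ (Fin 3)

/-- The round unit sphere `S²`, with the smooth structure of Mathlib. -/
abbrev S2 : Type := Metric.sphere (0 : E3) 1

/-- `v` is a unit vector field of class `C¹` on the open set `U` of the sphere. The vector `v p`,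
an element of the tangent plane at `p`, is written as a vector of `ℝ³` orthogonal to `p`; the
values of `v` outside `U` play no role. -/
structure IsUnitVectorFieldOn (v : S2 → E3) (U : Set S2) : Prop where
  contMDiffOn : ContMDiffOn (𝓡 2) 𝓘(ℝ, E3) 1 v U
  tangent : ∀ p ∈ U, ⟪v p, (p : E3)⟫_ℝ = 0
  norm_eq_one : ∀ p ∈ U, ‖v p‖ = 1

/-- Orthogonal projection of `ℝ³` onto the tangent plane of the sphere at `p`. -/
def tangentProj (p : S2) (x : E3) : E3 := x - ⟪x, (p : E3)⟫_ℝ • (p : E3)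

/-- The Sasaki metric on the tangent bundle of `S²`, at a point over `p`. The tangent bundle is
viewed as the set of pairs (base point, tangent vector) in `ℝ³ × ℝ³`, so that a tangent vector to
it is a pair `(X, ξ)`, the velocity of a curve `(c, u)` of base points and tangent vectors. Its
horizontal part is `X`, and its vertical part is the covariant derivative of `u` along `c`,
which is the tangential part of `ξ`. -/
def sasaki (p : S2) (Z W : E3 × E3) : ℝ :=
  ⟪Z.1, W.1⟫_ℝ + ⟪tangentProj p Z.2, tangentProj p W.2⟫_ℝ

/-- The differential at `p` of the inclusion of the sphere in `ℝ³`. -/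
def dIncl (p : S2) (X : TangentSpace (𝓡 2) p) : E3 :=
  mfderiv (𝓡 2) 𝓘(ℝ, E3) (fun q : S2 => (q : E3)) p X

/-- The differential at `p` of the section `q ↦ (q, v q)` of the tangent bundle. -/
def dSection (v : S2 → E3) (p : S2) (X : TangentSpace (𝓡 2) p) : E3 × E3 :=
  (dIncl p X, mfderiv (𝓡 2) 𝓘(ℝ, E3) v p X)

/-- A basis of the tangent space at `p`. -/
def tangentBasis (p : S2) (i : Fin 2) : TangentSpace (𝓡 2) p :=
  (EuclideanSpace.single i (1 : ℝ) : EuclideanSpace ℝ (Fin 2))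

/-- Gram matrix of the round metric in the basis `tangentBasis p`. -/
def roundGram (p : S2) : Matrix (Fin 2) (Fin 2) ℝ :=
  Matrix.of fun i j => ⟪dIncl p (tangentBasis p i), dIncl p (tangentBasis p j)⟫_ℝ

/-- Gram matrix, in the basis `tangentBasis p`, of the pull-back of the Sasaki metric by `v`. -/
def sasakiGram (v : S2 → E3) (p : S2) : Matrix (Fin 2) (Fin 2) ℝ :=
  Matrix.of fun i j =>
    sasaki p (dSection v p (tangentBasis p i)) (dSection v p (tangentBasis p j))

/-- The area element of the image of `v` in the unit tangent bundle with the Sasaki metric,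
relative to the area element of the round sphere. The quotient does not depend on the basis. -/
def areaDensity (v : S2 → E3) (p : S2) : ℝ :=
  √(sasakiGram v p).det / √(roundGram p).det

/-- The volume of the vector field `v` on `U`: the area, for the Sasaki metric, of the image
of `U` under the section `q ↦ (q, v q)`. It may be infinite. The measure is the usual surface
measure of the sphere, of total mass `4 π`. -/
def vol (v : S2 → E3) (U : Set S2) : ENNReal :=
  ∫⁻ p in U, ENNReal.ofReal (areaDensity v p) ∂((MeasureTheory.volume : MeasureTheory.Measure E3).toSphere)

/-- `k` is the Poincaré index at `P` of the vector field `v`, defined and without zeros on a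
punctured neighbourhood of `P`. Near `P` one uses the chart `q ↦ (⟪q, a⟫, ⟪q, b⟫)` of the
sphere, where `a, b` is an orthonormal basis of the tangent plane at `P`; the vector field reads
`(⟪v, a⟫, ⟪v, b⟫)` in it. The index is the number of turns that this planar vector makes when the
point goes once around a small circle centred at `P`; here `θ` is a continuous angle of it along
the circle of geodesic radius `r`. The orientation of `a, b` does not matter, as its change
reverses both the circle and the angle. -/
def IsPoincareIndex (v : S2 → E3) (P : S2) (k : ℤ) : Prop :=
  ∃ a b : E3, Orthonormal ℝ ![a, b, (P : E3)] ∧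
    ∀ᶠ r in 𝓝[>] (0 : ℝ), ∃ θ : ℝ → ℝ,
      ContinuousOn θ (Set.Icc 0 (2 * Real.pi)) ∧
      (∀ t ∈ Set.Icc 0 (2 * Real.pi), ∀ q : S2,
        (q : E3) = Real.cos r • (P : E3) + Real.sin r • (Real.cos t • a + Real.sin t • b) →
          ∃ c : ℝ, 0 < c ∧ ⟪v q, a⟫_ℝ = c * Real.cos (θ t) ∧ ⟪v q, b⟫_ℝ = c * Real.sin (θ t)) ∧
      θ (2 * Real.pi) - θ 0 = 2 * Real.pi * k

/-- The standard parametrization, over `[0, 2π]`, of the ellipse `x²/a² + y²/b² = 1`. -/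
def ellipseParam (a b : ℝ) (t : ℝ) : EuclideanSpace ℝ (Fin 2) :=
  !₂[a * Real.cos t, b * Real.sin t]

/-- The length of the ellipse `x²/a² + y²/b² = 1`. -/
def ellipseLength (a b : ℝ) : ℝ :=
  ∫ t in (0 : ℝ)..(2 * Real.pi), ‖deriv (ellipseParam a b) t‖

end SphereField

end

open scoped Manifold Topology InnerProductSpace

noncomputable section

namespace SphereField

open MeasureTheory Set Real

/-! Foliate the sphere minus the poles by latitude circles about one pole, of index `m`. Keeping
only the derivative of `v` in the unit latitude direction `e`, the area density is at least `√(1 +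
‖∇_e v‖²)` (`sqrt_le_areaDensity`). On the circle of polar angle `φ`, parametrized by longitude, let
`ω` be the angular speed of `v` in the frame of meridians and latitudes. This frame itself turns at
rate `cos φ` relative to parallel transport, so `sin φ ‖∇_e v‖ ≥ |ω + cos φ|` (`sin_sq_add_sq_le`).

The total rotation `∫ ω` is a continuous function of `φ` with values in `2πℤ`, hence constant; near
the pole the index gives its value `2π(m - 1)`, the frame accounting for one turn
(`integral_latSpeed`). Minkowski's inequality bounds the contribution of each circle below by `2π
√(sin² φ + (m - 1 + cos φ)²)`, and the integral of this over `φ` in `(0, π)` is `π` times the length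
of the ellipse with coefficients `m`, `m - 2` (`pi_mul_ellipseLength`). The theorem is this estimate
at the pole of larger index. -/

/-! ### Spherical coordinates and the surface measure. -/

/-- Radial projection onto the sphere, with the value `N` at the origin. -/
def radialProj (N : S2) (x : E3) : S2 :=
  ⟨if x = 0 then N else ‖x‖⁻¹ • x, by
    split_ifs with h
    · exact N.2
    · simp [norm_smul, h]⟩

lemma measurable_radialProj (N : S2) : Measurable (radialProj N) := by
  refine Measurable.subtype_mk ?_
  refine Measurable.ite (measurableSet_singleton _) measurable_const ?_
  fun_prop

lemma radialProj_smul (N : S2) {r : ℝ} (hr : 0 < r) (p : S2) :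
    radialProj N (r • (p : E3)) = p := by
  have hp : ‖(p : E3)‖ = 1 := by simp
  have h0 : (p : E3) ≠ 0 := by intro h; simp [h] at hp
  ext1
  simp [radialProj, hr.ne', h0, norm_smul, hp, abs_of_pos hr, smul_smul]

lemma radialProj_coe (N p : S2) : radialProj N (p : E3) = p := by
  simpa using radialProj_smul N one_pos p

/-- The point with polar angle `φ` and longitude `t` in the orthonormal basis `B`, the pole being
the last vector of `B`. -/
def polarPt (B : OrthonormalBasis (Fin 3) ℝ E3) (φ t : ℝ) : E3 :=
  cos φ • B 2 + sin φ • (cos t • B 0 + sin t • B 1)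

lemma inner_basis (B : OrthonormalBasis (Fin 3) ℝ E3) (i j : Fin 3) :
    ⟪B i, B j⟫_ℝ = if i = j then 1 else 0 :=
  orthonormal_iff_ite.mp B.orthonormal i j

lemma inner_polarPt_self (B : OrthonormalBasis (Fin 3) ℝ E3) (φ t : ℝ) :
    ⟪polarPt B φ t, polarPt B φ t⟫_ℝ = 1 := by
  simp only [polarPt, inner_add_left, inner_add_right, inner_smul_left, inner_smul_right,
    inner_basis]
  simp
  linear_combination (sin φ) ^ 2 * sin_sq_add_cos_sq t + sin_sq_add_cos_sq φ

lemma norm_polarPt (B : OrthonormalBasis (Fin 3) ℝ E3) (φ t : ℝ) : ‖polarPt B φ t‖ = 1 := by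
  have := inner_polarPt_self B φ t
  rw [real_inner_self_eq_norm_sq] at this
  nlinarith [norm_nonneg (polarPt B φ t)]

/-- `polarPt` as a point of the sphere. -/
def spherePt (B : OrthonormalBasis (Fin 3) ℝ E3) (φ t : ℝ) : S2 :=
  ⟨polarPt B φ t, by simp [norm_polarPt]⟩

@[simp] lemma coe_spherePt (B : OrthonormalBasis (Fin 3) ℝ E3) (φ t : ℝ) :
    (spherePt B φ t : E3) = polarPt B φ t := rfl

lemma continuous_polarPt (B : OrthonormalBasis (Fin 3) ℝ E3) :
    Continuous fun q : ℝ × ℝ => polarPt B q.1 q.2 := by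
  unfold polarPt; fun_prop

lemma continuous_spherePt (B : OrthonormalBasis (Fin 3) ℝ E3) :
    Continuous fun q : ℝ × ℝ => spherePt B q.1 q.2 :=
  (continuous_polarPt B).subtype_mk _

/-- The linear coordinates of the orthonormal basis `B`, the last one being split off. -/
def ofCoords (B : OrthonormalBasis (Fin 3) ℝ E3) (q : ℝ × ℝ × ℝ) : E3 :=
  q.2.1 • B 0 + q.2.2 • B 1 + q.1 • B 2

lemma measurePreserving_ofCoords (B : OrthonormalBasis (Fin 3) ℝ E3) :
    MeasurePreserving (ofCoords B) := by
  have h1 := (volume_preserving_finTwoArrow ℝ).symm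
  have h2 := (MeasurePreserving.id (volume : Measure ℝ)).prod h1
  have h3 := (volume_preserving_piFinSuccAbove (fun _ : Fin 3 => ℝ) 2).symm.comp h2
  have h4 := (B.measurePreserving_repr_symm.comp (PiLp.volume_preserving_toLp (Fin 3))).comp h3
  have h5 : ofCoords B = (B.repr.symm ∘ WithLp.toLp 2) ∘
      (MeasurableEquiv.piFinSuccAbove (fun _ : Fin 3 => ℝ) 2).symm ∘
        Prod.map id MeasurableEquiv.finTwoArrow.symm := by
    funext q
    rw [Function.comp_apply, Function.comp_apply, ← B.sum_repr (B.repr.symm _)]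
    simp only [LinearIsometryEquiv.apply_symm_apply, Fin.sum_univ_three, ofCoords]
    congr 1
  rw [h5]
  exact h4

/-- Lebesgue measure off the origin is the product of `toSphere` and `r² dr`. Computing the left
side in spherical coordinates and cancelling the radial factor then identifies `toSphere`. -/
lemma lintegral_radial_mul (N : S2) {g : S2 → ENNReal} (hg : Measurable g)
    {h : ℝ → ENNReal} (hh : Measurable h) :
    ∫⁻ x : E3, g (radialProj N x) * h ‖x‖ =
      (∫⁻ p, g p ∂((volume : Measure E3).toSphere)) *
        ∫⁻ r in Ioi (0 : ℝ), ENNReal.ofReal (r ^ 2) * h r := by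
  have key := (volume : Measure E3).measurePreserving_homeomorphUnitSphereProd
  have hd : Module.finrank ℝ E3 - 1 = 2 := by simp
  rw [hd] at key
  have hm : Measurable fun q : S2 × Ioi (0 : ℝ) => g q.1 * h q.2 := by fun_prop
  have h1 := key.lintegral_comp hm
  rw [lintegral_prod_mul (f := g) (g := fun r : Ioi (0 : ℝ) => h r) hg.aemeasurable
    (by fun_prop)] at h1
  have h2 : ∫⁻ r, h ((r : Ioi (0 : ℝ)) : ℝ) ∂(Measure.volumeIoiPow 2) =
      ∫⁻ r in Ioi (0 : ℝ), ENNReal.ofReal (r ^ 2) * h r := by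
    rw [Measure.volumeIoiPow, lintegral_withDensity_eq_lintegral_mul _ (by fun_prop)
      (by fun_prop)]
    exact lintegral_subtype_comap measurableSet_Ioi fun r : ℝ => ENNReal.ofReal (r ^ 2) * h r
  rw [h2] at h1
  rw [← h1, ← setLIntegral_univ, ← setLIntegral_congr (s := {(0 : E3)}ᶜ) (t := univ)
      (by simp [ae_eq_univ]), ← lintegral_subtype_comap (measurableSet_singleton (0 : E3)).compl]
  refine lintegral_congr fun x => ?_
  have hx : (x : E3) ≠ 0 := x.2
  congr 2
  · ext1
    simp [radialProj, hx]
  · simp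

lemma ofCoords_polar (B : OrthonormalBasis (Fin 3) ℝ E3) (r φ t : ℝ) :
    ofCoords B (r * cos φ, r * sin φ * cos t, r * sin φ * sin t) = r • polarPt B φ t := by
  simp only [ofCoords, polarPt]
  module

lemma measurable_ofCoords (B : OrthonormalBasis (Fin 3) ℝ E3) : Measurable (ofCoords B) := by
  unfold ofCoords; fun_prop

/-- Integration in spherical coordinates. -/
lemma lintegral_eq_spherical (B : OrthonormalBasis (Fin 3) ℝ E3) {H : E3 → ENNReal}
    (hH : Measurable H) :
    ∫⁻ x, H x = ∫⁻ r in Ioi (0 : ℝ), ∫⁻ φ in Ioo (-π) π, ENNReal.ofReal r *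
      (indicator (Ioi 0) ENNReal.ofReal (r * sin φ) *
        ∫⁻ t in Ioo (-π) π, H (r • polarPt B φ t)) := by
  have hHc : Measurable fun q => H (ofCoords B q) := hH.comp (measurable_ofCoords B)
  have hind : Measurable (indicator (Ioi (0 : ℝ)) ENNReal.ofReal) :=
    ENNReal.measurable_ofReal.indicator measurableSet_Ioi
  -- Polar coordinates are used twice: in the plane orthogonal to the axis, giving `(ρ, t)`, then in
  -- the `(z, ρ)` plane, giving `(r, φ)`. The indicator extends the half-plane `ρ > 0` by zero, so
  -- that the second change of variables runs over a whole plane.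
  set K : ℝ × ℝ → ENNReal := fun w => indicator (Ioi 0) ENNReal.ofReal w.2 *
    ∫⁻ t in Ioo (-π) π, H (ofCoords B (w.1, w.2 * cos t, w.2 * sin t)) with hKdef
  have hK : Measurable K := by
    refine (hind.comp measurable_snd).mul ?_
    refine Measurable.lintegral_prod_right'
      (f := fun w : (ℝ × ℝ) × ℝ =>
        H (ofCoords B (w.1.1, w.1.2 * cos w.2, w.1.2 * sin w.2))) ?_
    exact hHc.comp (by fun_prop)
  have h1 : ∫⁻ x, H x = ∫⁻ w, K w := by
    rw [← (measurePreserving_ofCoords B).lintegral_comp hH, Measure.volume_eq_prod,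
      lintegral_prod _ hHc.aemeasurable, Measure.volume_eq_prod, lintegral_prod _ hK.aemeasurable]
    refine lintegral_congr fun z => ?_
    rw [← Measure.volume_eq_prod, ← lintegral_comp_polarCoord_symm, polarCoord_target, Measure.volume_eq_prod,
      ← Measure.prod_restrict, lintegral_prod _ (by
        refine Measurable.aemeasurable ?_
        simp only [polarCoord_symm_apply, smul_eq_mul]
        exact Measurable.mul (by fun_prop) (hHc.comp (by fun_prop)))]
    rw [← lintegral_indicator measurableSet_Ioi]
    refine lintegral_congr fun ρ => ?_
    simp only [hKdef, polarCoord_symm_apply, smul_eq_mul]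
    by_cases hρ : ρ ∈ Ioi (0 : ℝ)
    · rw [indicator_of_mem hρ, indicator_of_mem hρ, lintegral_const_mul]
      exact hHc.comp (by fun_prop)
    · rw [indicator_of_notMem hρ, indicator_of_notMem hρ, zero_mul]
  rw [h1, ← lintegral_comp_polarCoord_symm, polarCoord_target, Measure.volume_eq_prod,
    ← Measure.prod_restrict, lintegral_prod _ (by
      refine Measurable.aemeasurable ?_
      simp only [polarCoord_symm_apply, smul_eq_mul]
      exact Measurable.mul (by fun_prop) (hK.comp (by fun_prop)))]
  simp only [hKdef, polarCoord_symm_apply, smul_eq_mul, ofCoords_polar]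

/-- The surface measure of the sphere in spherical coordinates. -/
lemma lintegral_toSphere_eq (B : OrthonormalBasis (Fin 3) ℝ E3) {g : S2 → ENNReal}
    (hg : Measurable g) :
    ∫⁻ p, g p ∂((volume : Measure E3).toSphere) =
      ∫⁻ φ in Ioo 0 π, ENNReal.ofReal (sin φ) * ∫⁻ t in Ioo (-π) π, g (spherePt B φ t) := by
  set N : S2 := spherePt B 0 0
  -- Any radial weight would do whose moment `c` is neither zero nor infinite, as `c` is cancelled
  -- at the end.
  set h : ℝ → ENNReal := indicator (Iio 1) 1 with hh
  have hhm : Measurable h := measurable_one.indicator measurableSet_Iio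
  set c := ∫⁻ r in Ioi (0 : ℝ), ENNReal.ofReal (r ^ 2) * h r with hc
  have hcv : c = ENNReal.ofReal (1 / 3) := by
    have : c = Measure.volumeIoiPow 2 (Iio ⟨1, mem_Ioi.2 one_pos⟩) := by
      rw [Measure.volumeIoiPow, withDensity_apply _ measurableSet_Iio,
        setLIntegral_subtype measurableSet_Ioi _ fun a : ℝ ↦ ENNReal.ofReal (a ^ 2),
        image_subtype_val_Ioi_Iio, hc, ← Ioi_inter_Iio, inter_comm,
        ← setLIntegral_indicator measurableSet_Iio]
      refine lintegral_congr fun r => ?_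
      by_cases hr : r ∈ Iio (1 : ℝ) <;> simp [hh, hr]
    rw [this, Measure.volumeIoiPow_apply_Iio]
    norm_num
  have hI : Measurable fun φ => ∫⁻ t in Ioo (-π) π, g (spherePt B φ t) :=
    Measurable.lintegral_prod_right' (f := fun w : ℝ × ℝ => g (spherePt B w.1 w.2))
      (hg.comp (continuous_spherePt B).measurable)
  have key := lintegral_radial_mul N hg hhm
  have hgh : Measurable fun x => g (radialProj N x) * h ‖x‖ :=
    (hg.comp (measurable_radialProj N)).mul (hhm.comp measurable_norm)
  rw [lintegral_eq_spherical B hgh] at key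
  have hcalc : ∀ r ∈ Ioi (0 : ℝ), (∫⁻ φ in Ioo (-π) π, ENNReal.ofReal r *
      (indicator (Ioi 0) ENNReal.ofReal (r * sin φ) *
        ∫⁻ t in Ioo (-π) π, g (radialProj N (r • polarPt B φ t)) * h ‖r • polarPt B φ t‖)) =
      ENNReal.ofReal (r ^ 2) * h r *
        ∫⁻ φ in Ioo 0 π, ENNReal.ofReal (sin φ) * ∫⁻ t in Ioo (-π) π, g (spherePt B φ t) := by
    intro r hr
    have hr0 : 0 < r := hr
    rw [← lintegral_const_mul _ (by fun_prop)]
    have hsub : Ioo 0 π = Ioo 0 π ∩ Ioo (-π) π := by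
      rw [inter_eq_left.2]; exact Ioo_subset_Ioo_left (by linarith [pi_pos])
    rw [hsub, ← setLIntegral_indicator measurableSet_Ioo]
    refine setLIntegral_congr_fun measurableSet_Ioo fun φ hφ => ?_
    by_cases h0 : φ ∈ Ioo 0 π
    · have hs : 0 < sin φ := sin_pos_of_mem_Ioo h0
      rw [indicator_of_mem h0, indicator_of_mem (mem_Ioi.2 (mul_pos hr0 hs))]
      have : ∀ t, g (radialProj N (r • polarPt B φ t)) * h ‖r • polarPt B φ t‖ =
          h r * g (spherePt B φ t) := by
        intro t
        rw [← coe_spherePt, radialProj_smul N hr0, norm_smul, coe_spherePt, norm_polarPt,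
          mul_one, norm_eq_abs, abs_of_pos hr0, mul_comm]
      simp_rw [this]
      have hgm : Measurable fun t => g (spherePt B φ t) :=
        hg.comp ((continuous_spherePt B).comp
          (by fun_prop : Continuous fun t : ℝ => (φ, t))).measurable
      rw [lintegral_const_mul _ hgm, ENNReal.ofReal_mul hr0.le, sq, ENNReal.ofReal_mul hr0.le]
      ring
    · have hs : ¬ 0 < r * sin φ := by
        have : φ ≤ 0 := by
          by_contra hc
          exact h0 ⟨not_le.1 hc, hφ.2⟩
        have := sin_nonpos_of_nonpos_of_neg_pi_le this hφ.1.le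
        exact not_lt.2 (mul_nonpos_of_nonneg_of_nonpos hr0.le this)
      rw [indicator_of_notMem h0, indicator_of_notMem (by simpa using hs)]
      simp
  rw [setLIntegral_congr_fun measurableSet_Ioi hcalc, lintegral_mul_const _ (by fun_prop), ← hc,
    mul_comm] at key
  refine ((ENNReal.mul_left_inj ?_ ?_).1 key).symm
  · simp [hcv]
  · simp [hcv]

/-! ### Radial extension of the field and the pointwise area estimate. -/

instance fact_finrank_E3 : Fact (Module.finrank ℝ E3 = 2 + 1) := ⟨by simp⟩

lemma contMDiffAt_radialProj (N : S2) {x : E3} (hx : x ≠ 0) :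
    ContMDiffAt 𝓘(ℝ, E3) (𝓡 2) 1 (radialProj N) x := by
  have hnorm : ContDiffAt ℝ 1 (fun y : E3 => ‖y‖⁻¹ • y) x :=
    ((contDiffAt_norm ℝ hx).inv (norm_ne_zero_iff.2 hx)).smul contDiffAt_id
  have hev : (fun y => (radialProj N y : E3)) =ᶠ[𝓝 x] fun y => ‖y‖⁻¹ • y := by
    filter_upwards [isOpen_ne.mem_nhds hx] with y hy
    have hy : y ≠ 0 := hy
    simp [radialProj, hy]
  have hcoe : ContDiffAt ℝ 1 (fun y => (radialProj N y : E3)) x := hnorm.congr_of_eventuallyEq hev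
  rw [contMDiffAt_iff_target]
  refine ⟨Topology.IsInducing.subtypeVal.continuousAt_iff.2 hcoe.continuousAt, ?_⟩
  -- The chart of the sphere at `p` is stereographic projection from `-p`, whose ambient formula is
  -- smooth where `⟪-p, y⟫ ≠ 1`; at `y = p` this product is `-1`.
  set p := radialProj N x with hp
  let U : _ ≃ₗᵢ[ℝ] _ :=
    (OrthonormalBasis.fromOrthogonalSpanSingleton (𝕜 := ℝ)
        2 (ne_zero_of_mem_unit_sphere (-p))).repr
  have hst : ContDiffAt ℝ 1 (stereoToFun ((-p : S2) : E3)) (p : E3) := by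
    refine (contDiffOn_stereoToFun.contDiffAt ?_).of_le le_top
    have : IsOpen {y : E3 | ⟪((-p : S2) : E3), y⟫_ℝ ≠ 1} :=
      isOpen_ne_fun (by fun_prop) (by fun_prop)
    refine this.mem_nhds ?_
    have : ⟪(p : E3), (p : E3)⟫_ℝ = 1 := by rw [real_inner_self_eq_norm_sq]; simp
    simp only [Metric.sphere, mem_ofPred_eq]
    rw [show ((-p : S2) : E3) = -(p : E3) from rfl, inner_neg_left, this]
    norm_num
  have h3 : ContDiffAt ℝ 1 (fun y => U (stereoToFun ((-p : S2) : E3) (radialProj N y : E3))) x :=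
    U.contDiff.contDiffAt.comp x
      (ContDiffAt.comp x (f := fun y => (radialProj N y : E3)) hst hcoe)
  exact h3.contMDiffAt

/-- The extension of `v` to space which is constant along rays. -/
def radialExt (N : S2) (v : S2 → E3) (x : E3) : E3 := v (radialProj N x)

lemma radialExt_coe (N : S2) (v : S2 → E3) (p : S2) : radialExt N v p = v p := by
  rw [radialExt, radialProj_coe]

lemma contDiffAt_radialExt (N : S2) {v : S2 → E3} {U : Set S2} (hU : IsOpen U)
    (hv : ContMDiffOn (𝓡 2) 𝓘(ℝ, E3) 1 v U) {p : S2} (hp : p ∈ U) :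
    ContDiffAt ℝ 1 (radialExt N v) (p : E3) := by
  have h1 : ContMDiffAt (𝓡 2) 𝓘(ℝ, E3) 1 v (radialProj N p) := by
    rw [radialProj_coe]; exact hv.contMDiffAt (hU.mem_nhds hp)
  exact (h1.comp (p : E3) (contMDiffAt_radialProj N (ne_zero_of_mem_unit_sphere p))).contDiffAt

/-- Since `v` is the restriction of `radialExt N v`, the chain rule replaces the manifold derivative
by a Fréchet derivative in `ℝ³`, where the later computations take place. -/
lemma mfderiv_eq_fderiv_radialExt (N : S2) {v : S2 → E3} {U : Set S2} (hU : IsOpen U)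
    (hv : ContMDiffOn (𝓡 2) 𝓘(ℝ, E3) 1 v U) {p : S2} (hp : p ∈ U) (X : TangentSpace (𝓡 2) p) :
    mfderiv (𝓡 2) 𝓘(ℝ, E3) v p X = fderiv ℝ (radialExt N v) p (dIncl p X) := by
  have h1 : v = radialExt N v ∘ fun q : S2 => (q : E3) := by
    funext q; exact (radialExt_coe N v q).symm
  have h2 : MDifferentiableAt 𝓘(ℝ, E3) 𝓘(ℝ, E3) (radialExt N v) (p : E3) :=
    ((contDiffAt_radialExt N hU hv hp).differentiableAt (by simp)).mdifferentiableAt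
  have h3 : MDifferentiableAt (𝓡 2) 𝓘(ℝ, E3) (fun q : S2 => (q : E3)) p :=
    (contMDiff_coe_sphere (m := 1) p).mdifferentiableAt (by simp)
  conv_lhs => rw [h1]
  rw [mfderiv_comp p h2 h3, mfderiv_eq_fderiv]
  rfl

/-- `tangentProj` as a linear map. -/
def tangentProjₗ (p : S2) : E3 →ₗ[ℝ] E3 where
  toFun := tangentProj p
  map_add' x y := by simp only [tangentProj, inner_add_left]; module
  map_smul' c x := by
    simp only [tangentProj, inner_smul_left, RingHom.id_apply, conj_trivial]; module

/-- If `w = x₁ l₁ + x₂ l₂` is a unit vector, the determinant of the sum of the Gram matrices of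
`l` and `u` controls the length of `x₁ u₁ + x₂ u₂`. -/
lemma det_gram_add_gram_ge {E F : Type*} [NormedAddCommGroup E] [InnerProductSpace ℝ E]
    [NormedAddCommGroup F] [InnerProductSpace ℝ F] (l₁ l₂ : E) (u₁ u₂ : F) (x₁ x₂ : ℝ)
    (hw : ‖x₁ • l₁ + x₂ • l₂‖ = 1) :
    (⟪l₁, l₁⟫_ℝ * ⟪l₂, l₂⟫_ℝ - ⟪l₁, l₂⟫_ℝ * ⟪l₁, l₂⟫_ℝ) * (1 + ‖x₁ • u₁ + x₂ • u₂‖ ^ 2) ≤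
      (⟪l₁, l₁⟫_ℝ + ⟪u₁, u₁⟫_ℝ) * (⟪l₂, l₂⟫_ℝ + ⟪u₂, u₂⟫_ℝ) -
        (⟪l₁, l₂⟫_ℝ + ⟪u₁, u₂⟫_ℝ) * (⟪l₁, l₂⟫_ℝ + ⟪u₁, u₂⟫_ℝ) := by
  have hcs : ⟪u₁, u₂⟫_ℝ * ⟪u₁, u₂⟫_ℝ ≤ ⟪u₁, u₁⟫_ℝ * ⟪u₂, u₂⟫_ℝ := by
    simpa [real_inner_comm] using real_inner_mul_inner_self_le u₁ u₂
  have hG : ⟪x₁ • l₁ + x₂ • l₂, x₁ • l₁ + x₂ • l₂⟫_ℝ = 1 := by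
    rw [real_inner_self_eq_norm_sq, hw, one_pow]
  -- With `w = x₁ l₁ + x₂ l₂`, these are `⟪w, l₂⟫` and `⟪w, l₁⟫`, so `y₁ l₁ - y₂ l₂` is orthogonal
  -- to `w`, of squared length the Gram determinant of `l`. Besides the two terms kept, the
  -- determinant of the sum contains the squared norm of `y₁ u₁ - y₂ u₂` and the Gram determinant of
  -- `u`, both nonnegative.
  set y₁ := x₁ * ⟪l₁, l₂⟫_ℝ + x₂ * ⟪l₂, l₂⟫_ℝ with hy₁
  set y₂ := x₁ * ⟪l₁, l₁⟫_ℝ + x₂ * ⟪l₁, l₂⟫_ℝ with hy₂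
  have hy : 0 ≤ ⟪y₁ • u₁ - y₂ • u₂, y₁ • u₁ - y₂ • u₂⟫_ℝ := real_inner_self_nonneg
  rw [← real_inner_self_eq_norm_sq]
  simp only [inner_add_left, inner_add_right, inner_sub_left, inner_sub_right, inner_smul_left,
    inner_smul_right, conj_trivial, real_inner_comm l₁ l₂, real_inner_comm u₁ u₂] at hG hy ⊢
  simp only [hy₁, hy₂] at hy
  linear_combination hcs + hy + (⟪l₂, l₂⟫_ℝ * ⟪u₁, u₁⟫_ℝ - 2 * ⟪l₁, l₂⟫_ℝ * ⟪u₁, u₂⟫_ℝ +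
    ⟪l₁, l₁⟫_ℝ * ⟪u₂, u₂⟫_ℝ) * hG

lemma dIncl_injective (p : S2) : Function.Injective (dIncl p) :=
  injective_mvfderiv_subtypeVal_sphere (n := 2) p

lemma exists_dIncl_eq (p : S2) {w : E3} (hw : ⟪w, (p : E3)⟫_ℝ = 0) :
    ∃ X : EuclideanSpace ℝ (Fin 2), dIncl p X = w := by
  have h : w ∈ (ℝ ∙ (p : E3))ᗮ := by
    rw [Submodule.mem_orthogonal_singleton_iff_inner_left]; exact hw
  rw [← range_mvfderiv_subtypeVal (n := 2) p] at h
  exact h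

/-- `dIncl p` as a linear map on the model space. -/
def dInclₗ (p : S2) : EuclideanSpace ℝ (Fin 2) →ₗ[ℝ] E3 :=
  (mfderiv (𝓡 2) 𝓘(ℝ, E3) (fun q : S2 => (q : E3)) p).toLinearMap

lemma det_roundGram_pos (p : S2) : 0 < (roundGram p).det := by
  set l₁ := dIncl p (tangentBasis p 0) with hl₁
  set l₂ := dIncl p (tangentBasis p 1) with hl₂
  have hdet : (roundGram p).det = ⟪l₁, l₁⟫_ℝ * ⟪l₂, l₂⟫_ℝ - ⟪l₁, l₂⟫_ℝ * ⟪l₁, l₂⟫_ℝ := by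
    rw [Matrix.det_fin_two]
    simp only [roundGram, Matrix.of_apply, ← hl₁, ← hl₂, real_inner_comm l₁ l₂]
  have hcs : ⟪l₁, l₂⟫_ℝ * ⟪l₁, l₂⟫_ℝ ≤ ⟪l₁, l₁⟫_ℝ * ⟪l₂, l₂⟫_ℝ := by
    simpa [real_inner_comm] using real_inner_mul_inner_self_le l₁ l₂
  refine lt_of_le_of_ne (by rw [hdet]; linarith) fun h0 => ?_
  rw [hdet] at h0
  -- Equality in Cauchy–Schwarz gives a linear relation. Injectivity of `dIncl p` kills its
  -- coefficient `⟪l₂, l₂⟫`, and then `l₂ = 0` contradicts injectivity again.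
  have hy : ⟪l₂, l₂⟫_ℝ • l₁ - ⟪l₁, l₂⟫_ℝ • l₂ = 0 := by
    rw [← inner_self_eq_zero (𝕜 := ℝ)]
    simp only [inner_sub_left, inner_sub_right, inner_smul_left,
      inner_smul_right, conj_trivial, real_inner_comm l₁ l₂]
    linear_combination - ⟪l₂, l₂⟫_ℝ * h0
  have hX : dInclₗ p (⟪l₂, l₂⟫_ℝ • EuclideanSpace.single 0 1 -
      ⟪l₁, l₂⟫_ℝ • EuclideanSpace.single 1 1) = dInclₗ p 0 := by
    rw [map_sub, map_smul, map_smul, map_zero]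
    exact hy
  have hX0 := congrArg (fun z : EuclideanSpace ℝ (Fin 2) => z 0) (dIncl_injective p hX)
  have h22 : l₂ = 0 := by simpa using hX0
  have hX' : dInclₗ p (EuclideanSpace.single 1 1) = dInclₗ p 0 := by
    rw [map_zero]; exact h22
  have := congrArg (fun z : EuclideanSpace ℝ (Fin 2) => z 1) (dIncl_injective p hX')
  simp at this

/-- The area density is bounded below by the stretching in any one tangent direction `w`. -/
lemma sqrt_le_areaDensity (N : S2) {v : S2 → E3} {U : Set S2} (hU : IsOpen U)
    (hv : ContMDiffOn (𝓡 2) 𝓘(ℝ, E3) 1 v U) {p : S2} (hp : p ∈ U) {w : E3} (hw : ‖w‖ = 1)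
    (hwp : ⟪w, (p : E3)⟫_ℝ = 0) :
    √(1 + ‖tangentProj p (fderiv ℝ (radialExt N v) p w)‖ ^ 2) ≤ areaDensity v p := by
  obtain ⟨X, hX⟩ := exists_dIncl_eq p hwp
  set l₁ := dIncl p (tangentBasis p 0) with hl₁
  set l₂ := dIncl p (tangentBasis p 1) with hl₂
  set T : E3 →ₗ[ℝ] E3 := tangentProjₗ p ∘ₗ (fderiv ℝ (radialExt N v) p).toLinearMap with hT
  have hXw : w = X 0 • l₁ + X 1 • l₂ := by
    have hXs : X = X 0 • EuclideanSpace.single 0 (1 : ℝ) + X 1 • EuclideanSpace.single 1 (1 : ℝ) := by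
      ext i; fin_cases i <;> simp
    calc w = dInclₗ p X := hX.symm
      _ = _ := by
        conv_lhs => rw [hXs, map_add, map_smul, map_smul]
        rfl
  have hTw : tangentProj p (fderiv ℝ (radialExt N v) p w) = X 0 • T l₁ + X 1 • T l₂ := by
    rw [← map_smul, ← map_smul, ← map_add, ← hXw]; rfl
  have key := det_gram_add_gram_ge l₁ l₂ (T l₁) (T l₂) (X 0) (X 1) (by rw [← hXw, hw])
  rw [← hTw] at key
  have hdet : (roundGram p).det = ⟪l₁, l₁⟫_ℝ * ⟪l₂, l₂⟫_ℝ - ⟪l₁, l₂⟫_ℝ * ⟪l₁, l₂⟫_ℝ := by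
    rw [Matrix.det_fin_two]
    simp only [roundGram, Matrix.of_apply, ← hl₁, ← hl₂, real_inner_comm l₁ l₂]
  have hS : ∀ i j, sasakiGram v p i j =
      ⟪dIncl p (tangentBasis p i), dIncl p (tangentBasis p j)⟫_ℝ +
        ⟪T (dIncl p (tangentBasis p i)), T (dIncl p (tangentBasis p j))⟫_ℝ := by
    intro i j
    simp only [sasakiGram, sasaki, dSection, Matrix.of_apply,
      mfderiv_eq_fderiv_radialExt N hU hv hp]
    rfl
  have hdetS : (sasakiGram v p).det = (⟪l₁, l₁⟫_ℝ + ⟪T l₁, T l₁⟫_ℝ) * (⟪l₂, l₂⟫_ℝ + ⟪T l₂, T l₂⟫_ℝ) -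
        (⟪l₁, l₂⟫_ℝ + ⟪T l₁, T l₂⟫_ℝ) * (⟪l₁, l₂⟫_ℝ + ⟪T l₁, T l₂⟫_ℝ) := by
    rw [Matrix.det_fin_two]
    simp only [hS, ← hl₁, ← hl₂, real_inner_comm l₁ l₂, real_inner_comm (T l₁) (T l₂)]
  have hpos := det_roundGram_pos p
  rw [areaDensity, le_div_iff₀ (sqrt_pos.2 hpos), ← sqrt_mul' _ hpos.le]
  apply sqrt_le_sqrt
  rw [hdetS, hdet, mul_comm]
  exact key

/-! ### Rotation of curves in the unit circle. -/

section PlaneCurve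

variable {x y x' y' : ℝ → ℝ}

lemma mul_deriv_add_mul_deriv_eq_zero (hx : ∀ t, HasDerivAt x (x' t) t)
    (hy : ∀ t, HasDerivAt y (y' t) t) (h1 : ∀ t, x t ^ 2 + y t ^ 2 = 1) (t : ℝ) :
    x t * x' t + y t * y' t = 0 := by
  have h2 := ((hx t).pow 2).add ((hy t).pow 2)
  have h3 : x ^ 2 + y ^ 2 = fun _ => (1 : ℝ) := funext h1
  rw [h3] at h2
  have := h2.unique (hasDerivAt_const t 1)
  simp at this
  linarith

/-- The lift of a curve in the unit circle to an angle. -/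
lemma unit_curve_eq_rotation (hx : ∀ t, HasDerivAt x (x' t) t)
    (hy : ∀ t, HasDerivAt y (y' t) t) (h1 : ∀ t, x t ^ 2 + y t ^ 2 = 1)
    (hx' : Continuous x') (hy' : Continuous y') (t : ℝ) :
    x t * cos (∫ s in (0 : ℝ)..t, (x s * y' s - y s * x' s)) +
        y t * sin (∫ s in (0 : ℝ)..t, (x s * y' s - y s * x' s)) = x 0 ∧
      y t * cos (∫ s in (0 : ℝ)..t, (x s * y' s - y s * x' s)) -
        x t * sin (∫ s in (0 : ℝ)..t, (x s * y' s - y s * x' s)) = y 0 := by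
  have hxc : Continuous x := continuous_iff_continuousAt.2 fun t => (hx t).continuousAt
  have hyc : Continuous y := continuous_iff_continuousAt.2 fun t => (hy t).continuousAt
  set ψ : ℝ → ℝ := fun t => ∫ s in (0 : ℝ)..t, (x s * y' s - y s * x' s) with hψ
  have hψd : ∀ t, HasDerivAt ψ (x t * y' t - y t * x' t) t := fun t =>
    (by fun_prop : Continuous fun s => x s * y' s - y s * x' s).integral_hasStrictDerivAt 0 t
      |>.hasDerivAt
  have hψ0 : ψ 0 = 0 := by simp [hψ]
  -- Turning the unit vector `(x, y)` back by its accumulated angle `ψ` leaves it constant.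
  have hd1 : ∀ t, HasDerivAt (fun t => x t * cos (ψ t) + y t * sin (ψ t)) 0 t := by
    intro t
    have h := ((hx t).mul (hψd t).cos).add ((hy t).mul (hψd t).sin)
    refine HasDerivAt.congr_deriv h ?_
    linear_combination (-x' t * cos (ψ t) - y' t * sin (ψ t)) * h1 t + (x t * cos (ψ t) + y t * sin (ψ t)) *
        mul_deriv_add_mul_deriv_eq_zero hx hy h1 t
  have hd2 : ∀ t, HasDerivAt (fun t => y t * cos (ψ t) - x t * sin (ψ t)) 0 t := by
    intro t
    have h := ((hy t).mul (hψd t).cos).sub ((hx t).mul (hψd t).sin)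
    refine HasDerivAt.congr_deriv h ?_
    linear_combination (-y' t * cos (ψ t) + x' t * sin (ψ t)) * h1 t + (y t * cos (ψ t) - x t * sin (ψ t)) *
        mul_deriv_add_mul_deriv_eq_zero hx hy h1 t
  have hc1 := is_const_of_deriv_eq_zero (fun t => (hd1 t).differentiableAt)
    (fun t => (hd1 t).deriv) t 0
  have hc2 := is_const_of_deriv_eq_zero (fun t => (hd2 t).differentiableAt)
    (fun t => (hd2 t).deriv) t 0
  simp only [hψ0, cos_zero, sin_zero, mul_one, mul_zero, add_zero, sub_zero] at hc1 hc2
  exact ⟨hc1, hc2⟩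

/-- The total rotation of a closed curve in the unit circle is a whole number of turns. -/
lemma exists_int_rotation (hx : ∀ t, HasDerivAt x (x' t) t)
    (hy : ∀ t, HasDerivAt y (y' t) t) (h1 : ∀ t, x t ^ 2 + y t ^ 2 = 1)
    (hx' : Continuous x') (hy' : Continuous y') {T : ℝ} (hxT : x T = x 0) (hyT : y T = y 0) :
    ∃ n : ℤ, (n : ℝ) * (2 * π) = ∫ s in (0 : ℝ)..T, (x s * y' s - y s * x' s) := by
  obtain ⟨h2, h3⟩ := unit_curve_eq_rotation hx hy h1 hx' hy' T
  rw [hxT, hyT] at h2 h3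
  -- A rotation that fixes the unit vector `(x 0, y 0)` has cosine `1`.
  apply (cos_eq_one_iff _).1
  linear_combination x 0 * h2 + y 0 * h3 +
    (1 - cos (∫ s in (0 : ℝ)..T, (x s * y' s - y s * x' s))) * h1 0

/-- A continuous angle on `[a, b]` with positive cosine cannot make a full turn. -/
lemma eq_zero_of_cos_pos {δ : ℝ → ℝ} {a b : ℝ} (hab : a ≤ b) (hδ : ContinuousOn δ (Icc a b))
    (hpos : ∀ t ∈ Icc a b, 0 < cos (δ t)) {n : ℤ} (hn : δ b - δ a = n * (2 * π)) : n = 0 := by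
  have hπ := pi_pos
  have ha := hpos a (left_mem_Icc.2 hab)
  rcases lt_trichotomy n 0 with h | h | h
  · have h' : (n : ℝ) ≤ -1 := by exact_mod_cast (by omega : n ≤ -1)
    -- A full turn would pass half a turn from the start, where the cosine is `-cos (δ a) < 0`.
    obtain ⟨t, ht, hte⟩ := intermediate_value_Icc' hab hδ
      (show δ a - π ∈ Icc (δ b) (δ a) from ⟨by nlinarith, by linarith⟩)
    have := hpos t ht
    rw [hte, cos_sub_pi] at this
    linarith
  · exact h
  · have h' : (1 : ℝ) ≤ n := by exact_mod_cast (by omega : 1 ≤ n)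
    obtain ⟨t, ht, hte⟩ := intermediate_value_Icc hab hδ
      (show δ a + π ∈ Icc (δ a) (δ b) from ⟨by linarith, by nlinarith⟩)
    have := hpos t ht
    rw [hte, cos_add_pi] at this
    linarith

/-- Comparison of the rotation of the unit vector `x + i y` in a frame that turns once, with the
number of turns `m` of the vector `exp(it) (σ x + i y)`. -/
lemma rotation_eq_of_angle (hx : ∀ t, HasDerivAt x (x' t) t)
    (hy : ∀ t, HasDerivAt y (y' t) t) (h1 : ∀ t, x t ^ 2 + y t ^ 2 = 1)
    (hx' : Continuous x') (hy' : Continuous y')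
    (hxT : x (2 * π) = x 0) (hyT : y (2 * π) = y 0) {σ : ℝ} (hσ : 0 < σ) {θ : ℝ → ℝ}
    (hθ : ContinuousOn θ (Icc 0 (2 * π)))
    (hθc : ∀ t ∈ Icc 0 (2 * π), ∃ c : ℝ, 0 < c ∧
      σ * x t * cos t - y t * sin t = c * cos (θ t) ∧
      σ * x t * sin t + y t * cos t = c * sin (θ t))
    {m : ℤ} (hm : θ (2 * π) - θ 0 = 2 * π * m) :
    ∫ s in (0 : ℝ)..(2 * π), (x s * y' s - y s * x' s) = 2 * π * (m - 1) := by
  have hxc : Continuous x := continuous_iff_continuousAt.2 fun t => (hx t).continuousAt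
  have hyc : Continuous y := continuous_iff_continuousAt.2 fun t => (hy t).continuousAt
  have hrot := unit_curve_eq_rotation hx hy h1 hx' hy'
  obtain ⟨n, hn⟩ := exists_int_rotation hx hy h1 hx' hy' hxT hyT
  set ψ : ℝ → ℝ := fun t => ∫ s in (0 : ℝ)..t, (x s * y' s - y s * x' s) with hψ
  have hψc : Continuous ψ := intervalIntegral.continuous_primitive
    (fun a b => (by fun_prop : Continuous fun s => x s * y' s - y s * x' s).intervalIntegrable a b) 0
  have hψ0 : ψ 0 = 0 := by simp [hψ]
  obtain ⟨α, hα1, hα2⟩ : ∃ α, cos α = x 0 ∧ sin α = y 0 := by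
    have hz : ‖(⟨x 0, y 0⟩ : ℂ)‖ = 1 := by
      rw [Complex.norm_def, Complex.normSq_mk, ← sq, ← sq, h1, sqrt_one]
    have hne : (⟨x 0, y 0⟩ : ℂ) ≠ 0 := by intro h; simp [h] at hz
    exact ⟨Complex.arg ⟨x 0, y 0⟩, by rw [Complex.cos_arg hne, hz, div_one],
      by rw [Complex.sin_arg, hz, div_one]⟩
  have hxψ : ∀ t, x t = cos (α + ψ t) := by
    intro t
    obtain ⟨h2, h3⟩ := hrot t
    rw [cos_add, hα1, hα2]
    linear_combination (-(x t)) * sin_sq_add_cos_sq (ψ t) + cos (ψ t) * h2 - sin (ψ t) * h3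
  have hyψ : ∀ t, y t = sin (α + ψ t) := by
    intro t
    obtain ⟨h2, h3⟩ := hrot t
    rw [sin_add, hα1, hα2]
    linear_combination (-(y t)) * sin_sq_add_cos_sq (ψ t) + sin (ψ t) * h2 + cos (ψ t) * h3
  -- Here `α + ψ` is the angle of `x + i y` and `θ - t` that of `σ x + i y`. The inner product `σ x²
  -- + y²` of these vectors is positive, so the two angles have the same total variation: `2π n = 2π
  -- m - 2π`.
  have hcos : ∀ t ∈ Icc 0 (2 * π), 0 < cos (α + ψ t - (θ t - t)) := by
    intro t ht
    obtain ⟨c, hc, h2, h3⟩ := hθc t ht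
    have h4 : c * cos (α + ψ t - (θ t - t)) = σ * x t ^ 2 + y t ^ 2 := by
      rw [cos_sub, ← hxψ, ← hyψ, cos_sub, sin_sub]
      linear_combination (-(x t * cos t - y t * sin t)) * h2 - (x t * sin t + y t * cos t) * h3 +
        (σ * x t ^ 2 + y t ^ 2) * sin_sq_add_cos_sq t
    have h5 : 0 < σ * x t ^ 2 + y t ^ 2 := by
      have := h1 t
      rcases eq_or_ne (x t) 0 with h | h
      · rw [h] at this ⊢; nlinarith
      · have := sq_pos_of_ne_zero h
        nlinarith [mul_pos hσ this, sq_nonneg (y t)]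
    rw [← h4] at h5
    exact (pos_iff_pos_of_mul_pos h5).1 hc
  have hd := eq_zero_of_cos_pos (δ := fun t => α + ψ t - (θ t - t)) (n := n - m + 1)
    (by positivity) (by fun_prop) hcos (by
      simp only [hψ0]
      rw [show ψ (2 * π) = n * (2 * π) from hn.symm]
      push_cast
      linear_combination -hm)
  have hnm : (n : ℝ) = m - 1 := by
    have : n = m - 1 := by omega
    rw [this]; push_cast; ring
  rw [← hn, hnm]; ring

end PlaneCurve

/-! ### The frame of meridians and latitude circles. -/

section LatitudeFrame

variable (B : OrthonormalBasis (Fin 3) ℝ E3)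

/-- Unit vector along the meridian at `polarPt B φ t`. -/
def polarDir (φ t : ℝ) : E3 := cos φ • (cos t • B 0 + sin t • B 1) - sin φ • B 2

/-- Unit vector along the latitude circle at `polarPt B φ t`. -/
def lonDir (t : ℝ) : E3 := -sin t • B 0 + cos t • B 1

lemma inner_lonDir_self (t : ℝ) : ⟪lonDir B t, lonDir B t⟫_ℝ = 1 := by
  simp only [lonDir, inner_add_left, inner_add_right, inner_smul_left, inner_smul_right,
    inner_basis]
  simp
  linear_combination sin_sq_add_cos_sq t

lemma inner_polarDir_self (φ t : ℝ) : ⟪polarDir B φ t, polarDir B φ t⟫_ℝ = 1 := by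
  simp only [polarDir, inner_add_left, inner_add_right, inner_smul_left, inner_smul_right,
    inner_basis, inner_sub_left, inner_sub_right]
  simp
  linear_combination (cos φ) ^ 2 * sin_sq_add_cos_sq t + sin_sq_add_cos_sq φ

lemma inner_polarDir_lonDir (φ t : ℝ) : ⟪polarDir B φ t, lonDir B t⟫_ℝ = 0 := by
  simp only [polarDir, lonDir, inner_add_left, inner_add_right, inner_smul_left,
    inner_smul_right, inner_basis, inner_sub_left]
  simp
  ring

lemma inner_polarPt_lonDir (φ t : ℝ) : ⟪polarPt B φ t, lonDir B t⟫_ℝ = 0 := by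
  simp only [polarPt, lonDir, inner_add_left, inner_add_right, inner_smul_left,
    inner_smul_right, inner_basis]
  simp
  ring

lemma inner_polarPt_polarDir (φ t : ℝ) : ⟪polarPt B φ t, polarDir B φ t⟫_ℝ = 0 := by
  simp only [polarPt, polarDir, inner_add_left, inner_add_right, inner_smul_left,
    inner_smul_right, inner_basis, inner_sub_right]
  simp
  linear_combination cos φ * sin φ * sin_sq_add_cos_sq t

lemma hasDerivAt_lonDir (φ t : ℝ) :
    HasDerivAt (lonDir B) (-(cos φ • polarDir B φ t + sin φ • polarPt B φ t)) t := by
  have h := ((hasDerivAt_sin t).neg.smul_const (B 0)).add ((hasDerivAt_cos t).smul_const (B 1))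
  refine HasDerivAt.congr_deriv h ?_
  have h1 := sin_sq_add_cos_sq φ
  have : cos φ • polarDir B φ t + sin φ • polarPt B φ t =
      (sin φ ^ 2 + cos φ ^ 2) • (cos t • B 0 + sin t • B 1) := by
    simp only [polarDir, polarPt]; module
  rw [this, h1]; module

lemma hasDerivAt_polarDir (φ t : ℝ) :
    HasDerivAt (polarDir B φ) (cos φ • lonDir B t) t := by
  have h := ((((hasDerivAt_cos t).smul_const (B 0)).add
    ((hasDerivAt_sin t).smul_const (B 1))).const_smul (cos φ)).sub_const (sin φ • B 2)
  exact HasDerivAt.congr_deriv h (by simp only [lonDir])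

lemma hasDerivAt_polarPt (φ t : ℝ) :
    HasDerivAt (polarPt B φ) (sin φ • lonDir B t) t := by
  have h := ((((hasDerivAt_cos t).smul_const (B 0)).add
    ((hasDerivAt_sin t).smul_const (B 1))).const_smul (sin φ)).const_add (cos φ • B 2)
  exact HasDerivAt.congr_deriv h (by simp only [lonDir])

end LatitudeFrame

/-! ### The field along a latitude circle. -/

section Latitude

variable {B : OrthonormalBasis (Fin 3) ℝ E3} {N : S2} {v : S2 → E3}

lemma spherePt_mem (hN : B 2 = (N : E3)) {φ : ℝ} (hφ : φ ∈ Ioo 0 π) (t : ℝ) :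
    spherePt B φ t ∈ ({N, -N}ᶜ : Set S2) := by
  have hs := sin_pos_of_mem_Ioo hφ
  have h1 : ⟪polarPt B φ t, B 2⟫_ℝ = cos φ := by
    simp [polarPt, inner_add_left, inner_smul_left]
  have h2 : ⟪B 2, B 2⟫_ℝ = 1 := by simp
  have h3 := sin_sq_add_cos_sq φ
  intro h
  rcases h with h | h
  · have h4 : polarPt B φ t = B 2 := by rw [hN, ← h]; rfl
    rw [h4, h2] at h1
    nlinarith
  · have h4 : polarPt B φ t = -B 2 := by
      rw [hN, ← coe_spherePt, mem_singleton_iff.1 h]; rfl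
    rw [h4, inner_neg_left, h2] at h1
    nlinarith

lemma isOpen_compl_poles (N : S2) : IsOpen ({N, -N}ᶜ : Set S2) :=
  (toFinite {N, -N}).isClosed.isOpen_compl

variable (B N v) in
/-- Derivative of `t ↦ v (spherePt B φ t)`. -/
def latDeriv (φ t : ℝ) : E3 :=
  fderiv ℝ (radialExt N v) (polarPt B φ t) (sin φ • lonDir B t)

lemma hasDerivAt_field (hv : IsUnitVectorFieldOn v {N, -N}ᶜ) (hN : B 2 = (N : E3)) {φ : ℝ}
    (hφ : φ ∈ Ioo 0 π) (t : ℝ) :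
    HasDerivAt (fun s => v (spherePt B φ s)) (latDeriv B N v φ t) t := by
  have h1 := (contDiffAt_radialExt N (isOpen_compl_poles N) hv.contMDiffOn
    (spherePt_mem hN hφ t)).differentiableAt (by simp)
  have h2 := h1.hasFDerivAt.comp_hasDerivAt t (hasDerivAt_polarPt B φ t)
  have h3 : (fun s => v (spherePt B φ s)) = radialExt N v ∘ polarPt B φ := by
    funext s
    rw [Function.comp_apply, ← coe_spherePt, radialExt_coe]
  rw [h3]
  exact h2

lemma continuous_latDeriv (hv : IsUnitVectorFieldOn v {N, -N}ᶜ) (hN : B 2 = (N : E3)) :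
    Continuous fun z : Ioo 0 π × ℝ => latDeriv B N v z.1 z.2 := by
  have h1 : ContinuousOn (fderiv ℝ (radialExt N v)) ((fun p : S2 => (p : E3)) '' {N, -N}ᶜ) := by
    rintro _ ⟨p, hp, rfl⟩
    exact ((contDiffAt_radialExt N (isOpen_compl_poles N) hv.contMDiffOn
      hp).continuousAt_fderiv (by simp)).continuousWithinAt
  have h2 : Continuous (fun z : Ioo 0 π × ℝ => polarPt B z.1 z.2) := by
    unfold polarPt; fun_prop
  have h3 : Continuous fun z : Ioo 0 π × ℝ => fderiv ℝ (radialExt N v) (polarPt B z.1 z.2) :=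
    h1.comp_continuous h2 fun z => ⟨spherePt B z.1 z.2, spherePt_mem hN z.1.2 z.2, rfl⟩
  have h4 : Continuous fun z : Ioo 0 π × ℝ => sin (z.1 : ℝ) • lonDir B z.2 := by
    unfold lonDir; fun_prop
  exact h3.clm_apply h4

lemma continuous_field (hv : IsUnitVectorFieldOn v {N, -N}ᶜ) (hN : B 2 = (N : E3)) :
    Continuous fun z : Ioo 0 π × ℝ => v (spherePt B z.1 z.2) := by
  have h1 : Continuous fun z : Ioo 0 π × ℝ => spherePt B z.1 z.2 := by
    refine Continuous.subtype_mk ?_ _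
    unfold polarPt; fun_prop
  exact hv.contMDiffOn.continuousOn.comp_continuous h1 fun z => spherePt_mem hN z.1.2 z.2

variable (B v) in
/-- Component of the field along the meridian. -/
def compPol (φ t : ℝ) : ℝ := ⟪v (spherePt B φ t), polarDir B φ t⟫_ℝ

variable (B v) in
/-- Component of the field along the latitude circle. -/
def compLon (φ t : ℝ) : ℝ := ⟪v (spherePt B φ t), lonDir B t⟫_ℝ

variable (B N v) in
/-- Derivative of `compPol` along the latitude circle. -/
def compPol' (φ t : ℝ) : ℝ := ⟪latDeriv B N v φ t, polarDir B φ t⟫_ℝ + cos φ * compLon B v φ t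

variable (B N v) in
/-- Derivative of `compLon` along the latitude circle. -/
def compLon' (φ t : ℝ) : ℝ := ⟪latDeriv B N v φ t, lonDir B t⟫_ℝ - cos φ * compPol B v φ t

lemma hasDerivAt_compPol (hv : IsUnitVectorFieldOn v {N, -N}ᶜ) (hN : B 2 = (N : E3))
    {φ : ℝ} (hφ : φ ∈ Ioo 0 π) (t : ℝ) :
    HasDerivAt (compPol B v φ) (compPol' B N v φ t) t := by
  have h := (hasDerivAt_field hv hN hφ t).inner ℝ (hasDerivAt_polarDir B φ t)
  refine HasDerivAt.congr_deriv h ?_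
  rw [inner_smul_right, compPol', compLon]; ring

lemma hasDerivAt_compLon (hv : IsUnitVectorFieldOn v {N, -N}ᶜ) (hN : B 2 = (N : E3))
    {φ : ℝ} (hφ : φ ∈ Ioo 0 π) (t : ℝ) :
    HasDerivAt (compLon B v φ) (compLon' B N v φ t) t := by
  have h := (hasDerivAt_field hv hN hφ t).inner ℝ (hasDerivAt_lonDir B φ t)
  refine HasDerivAt.congr_deriv h ?_
  have ht := hv.tangent _ (spherePt_mem hN hφ t)
  rw [coe_spherePt] at ht
  rw [inner_neg_right, inner_add_right, inner_smul_right, inner_smul_right, ht, compLon', compPol]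
  ring

lemma continuous_compPol (hv : IsUnitVectorFieldOn v {N, -N}ᶜ) (hN : B 2 = (N : E3)) :
    Continuous fun z : Ioo 0 π × ℝ => compPol B v z.1 z.2 := by
  refine (continuous_field hv hN).inner ?_
  unfold polarDir
  fun_prop

lemma continuous_compLon (hv : IsUnitVectorFieldOn v {N, -N}ᶜ) (hN : B 2 = (N : E3)) :
    Continuous fun z : Ioo 0 π × ℝ => compLon B v z.1 z.2 := by
  refine (continuous_field hv hN).inner ?_
  unfold lonDir
  fun_prop

lemma continuous_compPol' (hv : IsUnitVectorFieldOn v {N, -N}ᶜ) (hN : B 2 = (N : E3)) :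
    Continuous fun z : Ioo 0 π × ℝ => compPol' B N v z.1 z.2 := by
  have h1 := continuous_latDeriv hv hN
  have h2 := continuous_compLon hv hN
  unfold compPol' polarDir
  fun_prop

lemma continuous_compLon' (hv : IsUnitVectorFieldOn v {N, -N}ᶜ) (hN : B 2 = (N : E3)) :
    Continuous fun z : Ioo 0 π × ℝ => compLon' B N v z.1 z.2 := by
  have h1 := continuous_latDeriv hv hN
  have h2 := continuous_compPol hv hN
  unfold compLon' lonDir
  fun_prop

lemma compPol_sq_add_compLon_sq (hv : IsUnitVectorFieldOn v {N, -N}ᶜ) (hN : B 2 = (N : E3))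
    {φ : ℝ} (hφ : φ ∈ Ioo 0 π) (t : ℝ) :
    compPol B v φ t ^ 2 + compLon B v φ t ^ 2 = 1 := by
  have hmem := spherePt_mem hN hφ t
  have ht := hv.tangent _ hmem
  have h1 : ‖v (spherePt B φ t)‖ ^ 2 = 1 := by rw [hv.norm_eq_one _ hmem, one_pow]
  rw [← B.sum_sq_inner_left, Fin.sum_univ_three] at h1
  simp only [coe_spherePt, polarPt, inner_add_right, inner_smul_right] at ht
  simp only [compPol, compLon, polarDir, lonDir, inner_add_right, inner_sub_right,
    inner_smul_right]
  set a := ⟪v (spherePt B φ t), B 0⟫_ℝ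
  set b := ⟪v (spherePt B φ t), B 1⟫_ℝ
  set c := ⟪v (spherePt B φ t), B 2⟫_ℝ
  linear_combination h1 - (cos φ * c + sin φ * (cos t * a + sin t * b)) * ht +
    ((cos t * a + sin t * b) ^ 2 + c ^ 2) * sin_sq_add_cos_sq φ +
    (a ^ 2 + b ^ 2) * sin_sq_add_cos_sq t

/-- Projection to the plane of `B 0`, `B 1` multiplies the meridian component by `cos φ` and keeps
the latitude one. This is the form required by `rotation_eq_of_angle`, with `σ = cos φ`. -/
lemma inner_field_eq (hv : IsUnitVectorFieldOn v {N, -N}ᶜ) (hN : B 2 = (N : E3))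
    {φ : ℝ} (hφ : φ ∈ Ioo 0 π) (t : ℝ) :
    cos φ * compPol B v φ t * cos t - compLon B v φ t * sin t = ⟪v (spherePt B φ t), B 0⟫_ℝ ∧
    cos φ * compPol B v φ t * sin t + compLon B v φ t * cos t =
      ⟪v (spherePt B φ t), B 1⟫_ℝ := by
  have ht := hv.tangent _ (spherePt_mem hN hφ t)
  simp only [coe_spherePt, polarPt, inner_add_right, inner_smul_right] at ht
  simp only [compPol, compLon, polarDir, lonDir, inner_add_right, inner_sub_right,
    inner_smul_right]
  set a := ⟪v (spherePt B φ t), B 0⟫_ℝ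
  set b := ⟪v (spherePt B φ t), B 1⟫_ℝ
  set c := ⟪v (spherePt B φ t), B 2⟫_ℝ
  constructor
  · linear_combination (-sin φ * cos t) * ht +
      cos t * (cos t * a + sin t * b) * sin_sq_add_cos_sq φ + a * sin_sq_add_cos_sq t
  · linear_combination (-sin φ * sin t) * ht +
      sin t * (cos t * a + sin t * b) * sin_sq_add_cos_sq φ + b * sin_sq_add_cos_sq t

/-- The vector `w` in the proof is `v` turned by a quarter turn. The component of `sin φ • ∇_e v`
along `w` is the speed in the frame plus `cos φ`, and Cauchy–Schwarz bounds it by the norm. -/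
lemma sin_sq_add_sq_le (hv : IsUnitVectorFieldOn v {N, -N}ᶜ) (hN : B 2 = (N : E3))
    {φ : ℝ} (hφ : φ ∈ Ioo 0 π) (t : ℝ) :
    √(sin φ ^ 2 + (compPol B v φ t * compLon' B N v φ t - compLon B v φ t * compPol' B N v φ t +
      cos φ) ^ 2) ≤ sin φ * √(1 + ‖tangentProj (spherePt B φ t)
        (fderiv ℝ (radialExt N v) (spherePt B φ t) (lonDir B t))‖ ^ 2) := by
  have hs := (sin_pos_of_mem_Ioo hφ).le
  have h1 := compPol_sq_add_compLon_sq hv hN hφ t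
  set x := compPol B v φ t with hx
  set y := compLon B v φ t with hy
  set D := fderiv ℝ (radialExt N v) (spherePt B φ t) (lonDir B t) with hD
  set w := x • lonDir B t - y • polarDir B φ t with hw
  have hL : latDeriv B N v φ t = sin φ • D := by
    rw [latDeriv, map_smul, hD, coe_spherePt]
  have hww : ‖w‖ = 1 := by
    have : ⟪w, w⟫_ℝ = 1 := by
      simp only [hw, inner_sub_left, inner_sub_right, inner_smul_left, inner_smul_right,
        inner_lonDir_self, inner_polarDir_self, inner_polarDir_lonDir,
        real_inner_comm (polarDir B φ t) (lonDir B t)]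
      simp
      linear_combination h1
    rw [real_inner_self_eq_norm_sq] at this
    nlinarith [norm_nonneg w]
  have hPw : ⟪polarPt B φ t, w⟫_ℝ = 0 := by
    rw [hw, inner_sub_right, inner_smul_right, inner_smul_right, inner_polarPt_lonDir,
      inner_polarPt_polarDir]
    ring
  have hq : x * compLon' B N v φ t - y * compPol' B N v φ t + cos φ =
      sin φ * ⟪tangentProj (spherePt B φ t) D, w⟫_ℝ := by
    rw [tangentProj, inner_sub_left, inner_smul_left, coe_spherePt, hPw, hw, compLon', compPol', hL]
    simp only [inner_sub_right, inner_smul_left, inner_smul_right, conj_trivial, ← hx, ← hy]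
    linear_combination (-cos φ) * h1
  have hle : ⟪tangentProj (spherePt B φ t) D, w⟫_ℝ ^ 2 ≤ ‖tangentProj (spherePt B φ t) D‖ ^ 2 := by
    rw [← sq_abs]
    have := abs_real_inner_le_norm (tangentProj (spherePt B φ t) D) w
    rw [hww, mul_one] at this
    exact pow_le_pow_left₀ (abs_nonneg _) this 2
  rw [hq]
  apply sqrt_le_iff.2
  refine ⟨by positivity, ?_⟩
  rw [mul_pow, mul_pow, sq_sqrt (by positivity)]
  nlinarith [mul_le_mul_of_nonneg_left hle (sq_nonneg (sin φ))]

end Latitude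

/-! ### Total rotation along latitude circles and the index. -/

section Rotation

variable {B : OrthonormalBasis (Fin 3) ℝ E3} {N : S2} {v : S2 → E3}

variable (B N v) in
/-- Angular speed of the field along the latitude circle, in the frame of meridians and
latitude circles. -/
def latSpeed (φ t : ℝ) : ℝ :=
  compPol B v φ t * compLon' B N v φ t - compLon B v φ t * compPol' B N v φ t

lemma continuous_latSpeed (hv : IsUnitVectorFieldOn v {N, -N}ᶜ) (hN : B 2 = (N : E3)) :
    Continuous fun z : Ioo 0 π × ℝ => latSpeed B N v z.1 z.2 :=
  ((continuous_compPol hv hN).mul (continuous_compLon' hv hN)).sub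
    ((continuous_compLon hv hN).mul (continuous_compPol' hv hN))

lemma continuous_latitude {f : ℝ → ℝ → ℝ} (hf : Continuous fun z : Ioo 0 π × ℝ => f z.1 z.2)
    {φ : ℝ} (hφ : φ ∈ Ioo 0 π) : Continuous (f φ) :=
  hf.comp (by fun_prop : Continuous fun t : ℝ => ((⟨φ, hφ⟩ : Ioo 0 π), t))

variable (B) in
lemma spherePt_add_two_pi (φ t : ℝ) : spherePt B φ (t + 2 * π) = spherePt B φ t := by
  ext1; simp [polarPt]

variable (B) in
lemma lonDir_add_two_pi (t : ℝ) : lonDir B (t + 2 * π) = lonDir B t := by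
  simp [lonDir]

variable (B) in
lemma polarDir_add_two_pi (φ t : ℝ) : polarDir B φ (t + 2 * π) = polarDir B φ t := by
  simp [polarDir]

lemma compPol_add_two_pi (φ t : ℝ) : compPol B v φ (t + 2 * π) = compPol B v φ t := by
  rw [compPol, spherePt_add_two_pi, polarDir_add_two_pi, compPol]

lemma compLon_add_two_pi (φ t : ℝ) : compLon B v φ (t + 2 * π) = compLon B v φ t := by
  rw [compLon, spherePt_add_two_pi, lonDir_add_two_pi, compLon]

lemma latSpeed_periodic (φ : ℝ) : Function.Periodic (latSpeed B N v φ) (2 * π) := by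
  intro t
  have h : latDeriv B N v φ (t + 2 * π) = latDeriv B N v φ t := by
    rw [latDeriv, latDeriv, ← coe_spherePt, spherePt_add_two_pi, lonDir_add_two_pi, coe_spherePt]
  simp only [latSpeed, compPol', compLon', h, compPol_add_two_pi, compLon_add_two_pi,
    lonDir_add_two_pi, polarDir_add_two_pi]

/-- The rotation of the field along latitude circles does not depend on the circle, and is
determined by the index at the pole. -/
lemma integral_latSpeed (hv : IsUnitVectorFieldOn v {N, -N}ᶜ) (hN : B 2 = (N : E3)) {m : ℤ}
    (hm : ∀ᶠ r in 𝓝[>] (0 : ℝ), ∃ θ : ℝ → ℝ,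
      ContinuousOn θ (Icc 0 (2 * π)) ∧
      (∀ t ∈ Icc 0 (2 * π), ∀ q : S2,
        (q : E3) = cos r • (N : E3) + sin r • (cos t • B 0 + sin t • B 1) →
          ∃ c : ℝ, 0 < c ∧ ⟪v q, B 0⟫_ℝ = c * cos (θ t) ∧ ⟪v q, B 1⟫_ℝ = c * sin (θ t)) ∧
      θ (2 * π) - θ 0 = 2 * π * m) {φ : ℝ} (hφ : φ ∈ Ioo 0 π) :
    ∫ t in (0 : ℝ)..(2 * π), latSpeed B N v φ t = 2 * π * (m - 1) := by
  have hper : ∀ ψ, compPol B v ψ (2 * π) = compPol B v ψ 0 ∧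
      compLon B v ψ (2 * π) = compLon B v ψ 0 := fun ψ =>
    ⟨by simpa using compPol_add_two_pi (B := B) (v := v) ψ 0,
      by simpa using compLon_add_two_pi (B := B) (v := v) ψ 0⟩
  have hint : ∀ ψ : Ioo 0 π, ∃ n : ℤ,
      (n : ℝ) * (2 * π) = ∫ t in (0 : ℝ)..(2 * π), latSpeed B N v ψ t := fun ψ =>
    exists_int_rotation (hasDerivAt_compPol hv hN ψ.2) (hasDerivAt_compLon hv hN ψ.2)
      (compPol_sq_add_compLon_sq hv hN ψ.2) (continuous_latitude (continuous_compPol' hv hN) ψ.2)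
      (continuous_latitude (continuous_compLon' hv hN) ψ.2) (hper ψ).1 (hper ψ).2
  choose n hn using hint
  -- A continuous integer-valued function on the connected interval `(0, π)` is constant, so one
  -- small circle determines it.
  have hnc : Continuous n := by
    rw [Int.isClosedEmbedding_coe_real.isInducing.continuous_iff]
    have h1 : Continuous fun ψ : Ioo 0 π => ∫ t in (0 : ℝ)..(2 * π), latSpeed B N v ψ t :=
      intervalIntegral.continuous_parametric_intervalIntegral_of_continuous'
        (f := fun (ψ : Ioo 0 π) t => latSpeed B N v ψ t) (continuous_latSpeed hv hN) 0 (2 * π)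
    have h2 : (Int.cast ∘ n : Ioo 0 π → ℝ) =
        fun ψ : Ioo 0 π => (∫ t in (0 : ℝ)..(2 * π), latSpeed B N v ψ t) / (2 * π) := by
      funext ψ
      rw [Function.comp_apply, ← hn, mul_div_cancel_right₀ _ (by positivity)]
    rw [h2]
    exact h1.div_const _
  -- The radius is taken below `π / 2` so that `cos r`, in the role of `σ`, is positive.
  obtain ⟨r, ⟨θ, hθc, hθ, hθm⟩, hr⟩ :=
    (hm.and (Ioo_mem_nhdsGT (show (0 : ℝ) < π / 2 by positivity))).exists
  have hrπ : r ∈ Ioo 0 π := ⟨hr.1, by linarith [hr.2, pi_pos]⟩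
  have hcos : 0 < cos r := cos_pos_of_mem_Ioo ⟨by linarith [hr.1, pi_pos], hr.2⟩
  have hrot : ∫ t in (0 : ℝ)..(2 * π), latSpeed B N v r t = 2 * π * (m - 1) := by
    refine rotation_eq_of_angle (hasDerivAt_compPol hv hN hrπ) (hasDerivAt_compLon hv hN hrπ)
      (compPol_sq_add_compLon_sq hv hN hrπ) (continuous_latitude (continuous_compPol' hv hN) hrπ)
      (continuous_latitude (continuous_compLon' hv hN) hrπ) (hper r).1 (hper r).2 hcos hθc ?_ hθm
    intro t ht
    obtain ⟨c, hc, h1, h2⟩ := hθ t ht (spherePt B r t) (by rw [coe_spherePt, polarPt, hN])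
    obtain ⟨h3, h4⟩ := inner_field_eq hv hN hrπ t
    exact ⟨c, hc, h3.trans h1, h4.trans h2⟩
  have : PreconnectedSpace (Ioo 0 π) := Subtype.preconnectedSpace isPreconnected_Ioo
  have hconst : n ⟨φ, hφ⟩ = n ⟨r, hrπ⟩ := PreconnectedSpace.constant ‹_› hnc
  rw [← hn ⟨φ, hφ⟩, hconst, hn ⟨r, hrπ⟩, hrot]

end Rotation

/-! ### Minkowski's inequality and the length of the ellipse. -/

/-- Minkowski's inequality for the planar vector `(s, q t)`. -/
lemma sqrt_sq_add_integral_sq_le {q : ℝ → ℝ} (hq : Continuous q) {s a b : ℝ} (hab : a ≤ b) :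
    √(((b - a) * s) ^ 2 + (∫ t in a..b, q t) ^ 2) ≤ ∫ t in a..b, √(s ^ 2 + q t ^ 2) := by
  set I := ∫ t in a..b, q t
  set R := √(((b - a) * s) ^ 2 + I ^ 2) with hR
  have hR0 : 0 ≤ R := sqrt_nonneg _
  have hR2 : R ^ 2 = ((b - a) * s) ^ 2 + I ^ 2 := sq_sqrt (by positivity)
  have hc : Continuous fun t => √(s ^ 2 + q t ^ 2) := by fun_prop
  -- Cauchy–Schwarz against the integral `((b - a) s, I)` of the vector, whose norm is `R`.
  -- Integrated, the left side is `R²`, and a factor `R` is divided out.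
  have hpt : ∀ t, (b - a) * s * s + I * q t ≤ R * √(s ^ 2 + q t ^ 2) := by
    intro t
    rw [hR, ← sqrt_mul (by positivity)]
    apply le_sqrt_of_sq_le
    nlinarith [sq_nonneg ((b - a) * s * q t - I * s)]
  have hmono : ∫ t in a..b, ((b - a) * s * s + I * q t) ≤
      ∫ t in a..b, R * √(s ^ 2 + q t ^ 2) :=
    intervalIntegral.integral_mono hab
      ((by fun_prop : Continuous fun t => (b - a) * s * s + I * q t).intervalIntegrable a b)
      ((hc.const_mul R).intervalIntegrable a b) hpt
  rw [intervalIntegral.integral_const_mul, intervalIntegral.integral_add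
    (by simp) ((hq.const_mul I).intervalIntegrable a b), intervalIntegral.integral_const,
    intervalIntegral.integral_const_mul, smul_eq_mul] at hmono
  rcases hR0.eq_or_lt with h | h
  · rw [← h]
    exact intervalIntegral.integral_nonneg hab fun t _ => sqrt_nonneg _
  · have : R * R ≤ R * ∫ t in a..b, √(s ^ 2 + q t ^ 2) := by
      refine le_trans (le_of_eq ?_) hmono
      rw [← sq, hR2]; ring
    exact le_of_mul_le_mul_left this h

lemma norm_deriv_ellipseParam (a b t : ℝ) :
    ‖deriv (ellipseParam a b) t‖ = √((a * sin t) ^ 2 + (b * cos t) ^ 2) := by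
  have h : HasDerivAt (ellipseParam a b) (!₂[a * -sin t, b * cos t]) t := by
    have h1 : HasDerivAt (fun s => ![a * cos s, b * sin s]) ![a * -sin t, b * cos t] t := by
      rw [hasDerivAt_pi]
      intro i
      fin_cases i
      · simpa using (hasDerivAt_cos t).const_mul a
      · simpa using (hasDerivAt_sin t).const_mul b
    exact (PiLp.continuousLinearEquiv 2 ℝ
      (fun _ : Fin 2 => ℝ)).symm.hasFDerivAt.comp_hasDerivAt t h1
  rw [h.deriv, EuclideanSpace.norm_eq]
  simp

/-- The squared speed `(d + 1)² sin² t + (d - 1)² cos² t` equals `1 + d² - 2 d cos 2t`, which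
suggests `φ = π - 2t`. This covers two periods with factor `1/2`, that is one period, and evenness
in `φ` halves the range. -/
lemma pi_mul_ellipseLength (d : ℝ) :
    π * ellipseLength (d + 1) (d - 1) =
      ∫ φ in (0 : ℝ)..π, 2 * π * √(1 + d ^ 2 + 2 * d * cos φ) := by
  set g : ℝ → ℝ := fun φ => √(1 + d ^ 2 + 2 * d * cos φ) with hg
  have hgc : Continuous g := by fun_prop
  have hgp : Function.Periodic g (2 * π) := fun t => by simp [hg]
  have h1 : ellipseLength (d + 1) (d - 1) = ∫ t in (0 : ℝ)..(2 * π), g (π - 2 * t) := by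
    refine intervalIntegral.integral_congr fun t _ => ?_
    simp only [norm_deriv_ellipseParam, hg, cos_pi_sub, cos_two_mul]
    congr 1
    linear_combination (d + 1) ^ 2 * sin_sq_add_cos_sq t
  have h2 : ∫ t in (0 : ℝ)..(2 * π), g (π - 2 * t) = ∫ t in (-π)..π, g t := by
    rw [intervalIntegral.integral_comp_sub_mul g two_ne_zero π]
    have e1 : π - 2 * (2 * π) = -π + -(2 * π) := by ring
    have e2 : ∫ t in (-π + -(2 * π))..π, g t =
        (∫ t in (-π + -(2 * π))..(-π), g t) + ∫ t in (-π)..π, g t :=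
      (intervalIntegral.integral_add_adjacent_intervals (hgc.intervalIntegrable _ _)
        (hgc.intervalIntegrable _ _)).symm
    have e3 : ∫ t in (-π + -(2 * π))..(-π), g t = ∫ t in (-π)..π, g t := by
      have := hgp.intervalIntegral_add_eq (-π + -(2 * π)) (-π)
      rw [show -π + -(2 * π) + 2 * π = -π by ring, show -π + 2 * π = π by ring] at this
      exact this
    rw [e1, mul_zero, sub_zero, e2, e3, smul_eq_mul]
    ring
  have h3 : ∫ t in (-π)..π, g t = 2 * ∫ t in (0 : ℝ)..π, g t := by
    have e : ∫ t in (-π)..0, g t = ∫ t in (0 : ℝ)..π, g t := by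
      have := intervalIntegral.integral_comp_neg g (a := 0) (b := π)
      rw [neg_zero] at this
      rw [← this]
      simp [hg]
    rw [← intervalIntegral.integral_add_adjacent_intervals (hgc.intervalIntegrable (-π) 0)
      (hgc.intervalIntegrable 0 π), e]
    ring
  rw [h1, h2, h3, intervalIntegral.integral_const_mul]
  ring

/-! ### The volume estimate. -/

section Volume

variable {B : OrthonormalBasis (Fin 3) ℝ E3} {N : S2} {v : S2 → E3}

variable (B) in
/-- The unit vector along the latitude circle through a point outside the axis. -/
def lonDirAt (x : E3) : E3 :=
  (√(⟪x, B 0⟫_ℝ ^ 2 + ⟪x, B 1⟫_ℝ ^ 2))⁻¹ • (-⟪x, B 1⟫_ℝ • B 0 + ⟪x, B 0⟫_ℝ • B 1)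

lemma lonDirAt_polarPt {φ : ℝ} (hφ : φ ∈ Ioo 0 π) (t : ℝ) :
    lonDirAt B (polarPt B φ t) = lonDir B t := by
  have hs := sin_pos_of_mem_Ioo hφ
  have h0 : ⟪polarPt B φ t, B 0⟫_ℝ = sin φ * cos t := by
    simp [polarPt, inner_add_left, inner_smul_left]
  have h1 : ⟪polarPt B φ t, B 1⟫_ℝ = sin φ * sin t := by
    simp [polarPt, inner_add_left, inner_smul_left]
  have h2 : (sin φ * cos t) ^ 2 + (sin φ * sin t) ^ 2 = sin φ ^ 2 := by
    linear_combination sin φ ^ 2 * sin_sq_add_cos_sq t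
  rw [lonDirAt, h0, h1, h2, sqrt_sq hs.le, lonDir, smul_add, smul_smul, smul_smul]
  congr 2 <;> field_simp

lemma inner_lonDirAt (x : E3) : ⟪lonDirAt B x, x⟫_ℝ = 0 := by
  rw [lonDirAt, inner_smul_left, inner_add_left, inner_smul_left, inner_smul_left,
    real_inner_comm x (B 0), real_inner_comm x (B 1)]
  simp
  right; ring

lemma norm_lonDirAt (hN : B 2 = (N : E3)) {p : S2} (hp : p ∈ ({N, -N}ᶜ : Set S2)) :
    ‖lonDirAt B (p : E3)‖ = 1 := by
  set a := ⟪(p : E3), B 0⟫_ℝ with ha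
  set b := ⟪(p : E3), B 1⟫_ℝ with hb
  have hpos : 0 < a ^ 2 + b ^ 2 := by
    refine lt_of_le_of_ne (by positivity) fun h => hp ?_
    have ha0 : a = 0 := by nlinarith
    have hb0 : b = 0 := by nlinarith
    have hpe : (p : E3) = ⟪(p : E3), B 2⟫_ℝ • B 2 := by
      conv_lhs => rw [← B.sum_repr' (p : E3)]
      rw [Fin.sum_univ_three, real_inner_comm, ← ha, ha0, real_inner_comm (p : E3) (B 1), ← hb, hb0,
        real_inner_comm]
      simp
    have hn := congrArg norm hpe
    rw [norm_smul, B.norm_eq_one, mul_one, norm_eq_of_mem_sphere, norm_eq_abs] at hn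
    rcases eq_or_eq_neg_of_abs_eq hn.symm with h | h
    · left; ext1; rw [hpe, h, one_smul, hN]
    · right; ext1; rw [hpe, h, neg_one_smul, hN]; rfl
  have hsq : ‖-b • B 0 + a • B 1‖ ^ 2 = a ^ 2 + b ^ 2 := by
    rw [← real_inner_self_eq_norm_sq]
    simp only [inner_add_left, inner_add_right, inner_smul_left, inner_smul_right, inner_basis]
    simp
    ring
  rw [lonDirAt, ← ha, ← hb, norm_smul, ← hsq, sqrt_sq (norm_nonneg _), norm_inv, norm_norm]
  refine inv_mul_cancel₀ fun h => ?_
  rw [h] at hsq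
  nlinarith

/-- Lower bound of the volume by the index at the pole `N`. -/
lemma vol_ge_of_index (hv : IsUnitVectorFieldOn v {N, -N}ᶜ) {m : ℤ}
    (hm : IsPoincareIndex v N m) :
    ENNReal.ofReal (π * ellipseLength m (m - 2)) ≤ vol v {N, -N}ᶜ := by
  obtain ⟨a, b, hab, hidx⟩ := hm
  obtain ⟨B, hB⟩ : ∃ B : OrthonormalBasis (Fin 3) ℝ E3, (B : Fin 3 → E3) = ![a, b, (N : E3)] :=
    ⟨OrthonormalBasis.mk hab (by
      rw [hab.linearIndependent.span_eq_top_of_card_eq_finrank (by simp)]),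
      OrthonormalBasis.coe_mk _ _⟩
  have hN : B 2 = (N : E3) := by rw [hB]; rfl
  have h0 : a = B 0 := by rw [hB]; rfl
  have h1 : b = B 1 := by rw [hB]; rfl
  rw [h0, h1] at hidx
  -- The lower bound is written in ambient terms through `lonDirAt`, so that it is measurable on the
  -- whole sphere, as integration in spherical coordinates requires.
  set G : S2 → ENNReal := fun p => ENNReal.ofReal
    (√(1 + ‖tangentProj p (fderiv ℝ (radialExt N v) p (lonDirAt B p))‖ ^ 2)) with hG
  have hGm : Measurable G := by
    have h2 : Measurable fun p : S2 => fderiv ℝ (radialExt N v) (p : E3) (lonDirAt B p) := by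
      simp only [lonDirAt, map_smul, map_add]
      have h3 : ∀ y, Measurable fun p : S2 => fderiv ℝ (radialExt N v) (p : E3) y := fun y =>
        (measurable_fderiv_apply_const ℝ (radialExt N v) y).comp measurable_subtype_coe
      have h4 := h3 (B 0)
      have h5 := h3 (B 1)
      fun_prop
    simp only [hG, tangentProj]
    fun_prop
  have hU : MeasurableSet ({N, -N}ᶜ : Set S2) := (isOpen_compl_poles N).measurableSet
  have hstep1 : ∫⁻ p in {N, -N}ᶜ, G p ∂((volume : Measure E3).toSphere) ≤ vol v {N, -N}ᶜ := by
    refine setLIntegral_mono' hU fun p hp => ENNReal.ofReal_le_ofReal ?_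
    exact sqrt_le_areaDensity N (isOpen_compl_poles N) hv.contMDiffOn hp (norm_lonDirAt hN hp)
      (inner_lonDirAt _)
  refine le_trans ?_ hstep1
  rw [← lintegral_indicator hU, lintegral_toSphere_eq B (hGm.indicator hU)]
  -- With `d = m - 1`, the coefficients `d + 1` and `d - 1` are `m` and `m - 2`.
  have hd := pi_mul_ellipseLength ((m : ℝ) - 1)
  rw [sub_add_cancel, show (m : ℝ) - 1 - 1 = m - 2 by ring] at hd
  have hcont : Continuous fun φ : ℝ =>
      2 * π * √(1 + ((m : ℝ) - 1) ^ 2 + 2 * ((m : ℝ) - 1) * cos φ) := by fun_prop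
  rw [hd, intervalIntegral.integral_of_le pi_pos.le, ofReal_integral_eq_lintegral_ofReal
    (hcont.integrableOn_Ioc) (ae_of_all _ fun φ => by positivity),
    ← restrict_Ioo_eq_restrict_Ioc]
  refine setLIntegral_mono' measurableSet_Ioo fun φ hφ => ?_
  have hs := (sin_pos_of_mem_Ioo hφ).le
  rw [← lintegral_const_mul' _ _ ENNReal.ofReal_ne_top]
  have hqc : Continuous fun t => latSpeed B N v φ t + cos φ :=
    (continuous_latitude (continuous_latSpeed hv hN) hφ).add continuous_const
  have hsc : Continuous fun t => √(sin φ ^ 2 + (latSpeed B N v φ t + cos φ) ^ 2) := by fun_prop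
  have hI : ∫ t in (-π)..π, (latSpeed B N v φ t + cos φ) = 2 * π * ((m : ℝ) - 1 + cos φ) := by
    -- Spherical coordinates use longitudes in `(-π, π)`, the index uses `[0, 2π]`; periodicity
    -- reconciles them.
    have h2 := (latSpeed_periodic (B := B) (N := N) (v := v) φ).intervalIntegral_add_eq (-π) 0
    rw [show -π + 2 * π = π by ring, zero_add, integral_latSpeed hv hN hidx hφ] at h2
    rw [intervalIntegral.integral_add
      ((continuous_latitude (continuous_latSpeed hv hN) hφ).intervalIntegrable _ _) (by simp), h2,
      intervalIntegral.integral_const, smul_eq_mul]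
    ring
  calc ENNReal.ofReal (2 * π * √(1 + ((m : ℝ) - 1) ^ 2 + 2 * ((m : ℝ) - 1) * cos φ))
      ≤ ENNReal.ofReal (∫ t in (-π)..π, √(sin φ ^ 2 + (latSpeed B N v φ t + cos φ) ^ 2)) := by
        refine ENNReal.ofReal_le_ofReal (le_trans (le_of_eq ?_)
          (sqrt_sq_add_integral_sq_le hqc (by linarith [pi_pos])))
        rw [hI]
        nth_rw 1 [← sqrt_sq (show 0 ≤ 2 * π by positivity)]
        rw [← sqrt_mul (by positivity)]
        congr 1
        linear_combination (-4 * π ^ 2) * sin_sq_add_cos_sq φ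
    _ = ∫⁻ t in Ioo (-π) π,
          ENNReal.ofReal (√(sin φ ^ 2 + (latSpeed B N v φ t + cos φ) ^ 2)) := by
        rw [intervalIntegral.integral_of_le (by linarith [pi_pos]),
          ofReal_integral_eq_lintegral_ofReal hsc.integrableOn_Ioc
            (ae_of_all _ fun t => sqrt_nonneg _), ← restrict_Ioo_eq_restrict_Ioc]
    _ ≤ _ := by
        refine lintegral_mono fun t => ?_
        rw [indicator_of_mem (spherePt_mem hN hφ t), ← ENNReal.ofReal_mul hs]
        refine ENNReal.ofReal_le_ofReal ?_
        have h2 := sin_sq_add_sq_le hv hN hφ t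
        rw [← lonDirAt_polarPt hφ t] at h2
        exact h2

end Volume

end SphereField
end

theorem theorem1p1 (N : SphereField.S2) (v : SphereField.S2 → SphereField.E3)
    (hv : SphereField.IsUnitVectorFieldOn v {N, -N}ᶜ)
    (m n k : ℤ)
    (hm : SphereField.IsPoincareIndex v N m)
    (hn : SphereField.IsPoincareIndex v (-N) n)
    (hk : k = max m n) (hk2 : 2 < k) :
    ENNReal.ofReal (Real.pi * SphereField.ellipseLength (k : ℝ) ((k : ℝ) - 2)) ≤
      SphereField.vol v {N, -N}ᶜ := by
  rcases max_choice m n with h | h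
  · rw [hk, h]
    exact SphereField.vol_ge_of_index hv hm
  -- The pair of poles is symmetric, so the estimate applies with `-N` as the pole.
  · have hset : ({N, -N}ᶜ : Set SphereField.S2) = {-N, - -N}ᶜ := by
      rw [neg_neg, Set.pair_comm]
    rw [hset] at hv ⊢
    rw [hk, h]
    exact SphereField.vol_ge_of_index hv hn
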